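/- Let $\mathbf{E}$ and $\mathbf{S}$ be elementary toposes (categories with finite limits, exponentials and a subobject classifier) and let $F \dashv U : \mathbf{E} \to \mathbf{S}$ be a geometric morphism, i.e. $F : \mathbf{S} \to \mathbf{E}$ is a finite-limit preserving functor with right adjoint $U : \mathbf{E} \to \mathbf{S}$. Call $F \dashv U$ bounded if there is an object $B \in \mathbf{E}$ such that for every $X \in \mathbf{E}$ there are an object $I \in \mathbf{S}$, a monomorphism $C \rightarrowtail B \times FI$ and an epimorphism $C \twoheadrightarrow X$ in $\mathbf{E}$. Let $\mathsf{gl}(F) : \mathbf{E}{\downarrow}F \to \mathbf{S}$ be the fibration obtained by glueing: the objects of $\mathbf{E}{\downarrow}F$ are the arrows $a : A \to FI$ of $\mathbf{E}$ with $I \in \mathbf{S}$, a morphism from $b : B' \to FJ$ to $a : A \to FI$ is a pair $(e : B' \to A,\ u : J \to I)$ with $a \circ e = Fu \circ b$, and $\mathsf{gl}(F)$ sends $a$ to $I$ and $(e,u)$ to $u$. A generating family for a fibration $P : \mathbf{X} \to \mathbf{B}$ is an object $G$ of $\mathbf{X}$ (over an arbitrary object of $\mathbf{B}$) such that for every parallel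 pair of distinct vertical arrows $\alpha_1, \alpha_2 : X \to Y$ in $\mathbf{X}$ there exist a cartesian arrow $\varphi : Z \to G$ and an arrow $\psi : Z \to X$ with $\alpha_1 \circ \psi \neq \alpha_2 \circ \psi$. Here an arrow $\alpha$ is vertical if $P(\alpha)$ is an identity, and $\varphi : Z \to G$ is cartesian if for every $\theta : W \to G$ and every $v : P(W) \to P(Z)$ with $P(\theta) = P(\varphi) \circ v$ there is a unique $\chi : W \to Z$ with $P(\chi) = v$ and $\varphi \circ \chi = \theta$. Theorem. The geometric morphism $F \dashv U : \mathbf{E} \to \mathbf{S}$ is bounded if and only if there exists a generating family for the fibration $\mathsf{gl}(F)$. -/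

import Mathlib

open CategoryTheory CategoryTheory.Limits CategoryTheory.MonoidalCategory

universe v₁ v₂ u₁ u₂

namespace FibTopos

/-- A geometric morphism `F ⊣ U : E → S`: an adjunction whose left adjoint `F : S ⥤ E`
(the inverse image part) preserves finite limits. -/
structure GeometricMorphism (E : Type u₁) [Category.{v₁} E] (S : Type u₂) [Category.{v₂} S] where
  /-- The inverse image functor `F : S ⥤ E`. -/
  inverseImage : S ⥤ E
  /-- The direct image functor `U : E ⥤ S`. -/
  directImage : E ⥤ S
  /-- The adjunction `F ⊣ U`. -/
  adj : inverseImage ⊣ directImage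
  /-- The inverse image functor preserves finite limits. -/
  preservesFiniteLimits : PreservesFiniteLimits inverseImage

/-- `B` is a bound for `F ⊣ U : E → S` if every `X` in `E` is a quotient of a subobject `C` of
`B × F I` for some `I` in `S`. -/
def GeometricMorphism.IsBound {E : Type u₁} [Category.{v₁} E] [CartesianMonoidalCategory E]
    {S : Type u₂} [Category.{v₂} S] (f : GeometricMorphism E S) (B : E) : Prop :=
  ∀ X : E, ∃ (I : S) (C : E) (m : C ⟶ B ⊗ f.inverseImage.obj I) (e : C ⟶ X), Mono m ∧ Epi e

/-- A geometric morphism is bounded if it has a bound. -/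
def GeometricMorphism.IsBounded {E : Type u₁} [Category.{v₁} E] [CartesianMonoidalCategory E]
    {S : Type u₂} [Category.{v₂} S] (f : GeometricMorphism E S) : Prop :=
  ∃ B : E, f.IsBound B

/-- The glueing `gl(F) : E ↓ F ⥤ S` of a functor `F : S ⥤ E`. Objects of the total category
`E ↓ F` are arrows `a : A ⟶ F I` of `E`, morphisms from `b : B ⟶ F J` to `a : A ⟶ F I` are pairs
`(e : B ⟶ A, u : J ⟶ I)` with `e ≫ a = b ≫ F u`, and `gl(F)` sends `a` to `I` and `(e, u)`
to `u`. -/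
abbrev gl {E : Type u₁} [Category.{v₁} E] {S : Type u₂} [Category.{v₂} S] (F : S ⥤ E) :
    Comma (𝟭 E) F ⥤ S :=
  Comma.snd (𝟭 E) F

/-- If `E` has pullbacks then `gl(F)` is a fibration. -/
instance gl_isFibered {E : Type u₁} [Category.{v₁} E] [HasPullbacks E] {S : Type u₂}
    [Category.{v₂} S] (F : S ⥤ E) : (gl F).IsFibered := by
  refine Functor.IsFibered.of_exists_isStronglyCartesian fun a J u => ?_
  let b : Comma (𝟭 E) F :=
    { left := pullback a.hom (F.map u), right := J, hom := pullback.snd a.hom (F.map u) }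
  let φ : b ⟶ a :=
    { left := pullback.fst a.hom (F.map u), right := u, w := pullback.condition }
  refine ⟨b, φ, ?_⟩
  have h0 : (gl F).IsHomLift u φ := Functor.IsHomLift.map (p := gl F) φ
  refine { toIsHomLift := h0, universal_property' := ?_ }
  intro c g ψ hψ
  have hr : ψ.right = g ≫ u := (IsHomLift.eq_of_isHomLift (gl F) (g ≫ u) ψ).symm
  have hw : ψ.left ≫ a.hom = (c.hom ≫ F.map g) ≫ F.map u := by
    have := ψ.w
    rw [hr] at this
    simpa using this
  let χ : c ⟶ b :=
    { left := pullback.lift ψ.left (c.hom ≫ F.map g) hw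
      right := g
      w := pullback.lift_snd _ _ _ }
  have hχ : (gl F).IsHomLift g χ := Functor.IsHomLift.map (p := gl F) χ
  refine ⟨χ, ⟨hχ, ?_⟩, ?_⟩
  · ext
    · exact pullback.lift_fst _ _ _
    · exact hr.symm
  · rintro θ ⟨hθ, hθφ⟩
    have hθr : θ.right = g :=
      (IsHomLift.eq_of_isHomLift (a := c) (b := b) (gl F) g θ).symm
    apply CommaMorphism.ext
    · apply pullback.hom_ext
      · refine Eq.trans ?_ (pullback.lift_fst _ _ _).symm
        exact congrArg CommaMorphism.left hθφ
      · refine Eq.trans ?_ (pullback.lift_snd _ _ _).symm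
        have := θ.w
        rw [hθr] at this
        exact this
    · exact hθr

/-- An object `G` of the total category of a fibration `p` is a generating family for `p` if for
any two distinct parallel vertical arrows `α₁ α₂ : X ⟶ Y` there are a cartesian arrow `φ : Z ⟶ G`
and an arrow `ψ : Z ⟶ X` with `α₁ ∘ ψ ≠ α₂ ∘ ψ`. The object `G` lies over `I = p.obj G`, which is
arbitrary. Vertical arrows are those lying over an identity, and cartesian arrows have the lifting
property with respect to all arrows of the base, not just with respect to identities. -/
def IsGeneratingFamily {𝒳 : Type u₁} [Category.{v₁} 𝒳] {ℬ : Type u₂} [Category.{v₂} ℬ]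
    (p : 𝒳 ⥤ ℬ) [p.IsFibered] (G : 𝒳) : Prop :=
  ∀ (J : ℬ) (X Y : 𝒳) (α₁ α₂ : X ⟶ Y), p.IsHomLift (𝟙 J) α₁ → p.IsHomLift (𝟙 J) α₂ → α₁ ≠ α₂ →
    ∃ (Z : 𝒳) (φ : Z ⟶ G) (ψ : Z ⟶ X),
      p.IsStronglyCartesian (p.map φ) φ ∧ ψ ≫ α₁ ≠ ψ ≫ α₂

end FibTopos

namespace FibTopos

open CartesianMonoidalCategory MonoidalClosed HasSubobjectClassifier

section Topos

variable {E : Type u₁} [Category.{v₁} E]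

/-! Transposing across `F ⊣ U` and the exponential adjunction, every map `A × F L ⟶ W` is a
reindexing of one evaluation `A × F U (W ^ A) ⟶ W`. With `W = Ω`, this makes the subobjects of a
bound `B` a single family that reindexes to every subobject of `B × F L`, and it generates.
Conversely, for a generating family `G` and an object `X`, take `W = Ω ^ X`, an injective object
containing `X` via `singleton`. Partial maps `G.left × F L ⇀ X` extend to total maps into `W`, so
all of them factor through the pullback of `singleton` along the evaluation. Its projection to `X`
is therefore epic. -/

/-- The subobject classifier is an injective object. -/
instance injective_Ω [HasPullbacks E] [HasSubobjectClassifier E] : Injective (Ω E) where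
  factors {A B} g f hf := by
    let i : pullback g (truth E) ⟶ A := pullback.fst g (truth E)
    refine ⟨χ (i ≫ f), ?_⟩
    have h₁ : IsPullback i (Subobject.Classifier.χ₀ _ _) g (truth E) := by
      convert IsPullback.of_hasPullback g (truth E) using 1
      exact Subobject.Classifier.isTerminalΩ₀.hom_ext _ _
    -- Since `f` is monic, `i ≫ f` pulls back along `f` to `i`, so `f ≫ χ (i ≫ f)` and `g` classify
    -- the same subobject.
    have h₂ : IsPullback i (𝟙 _) f (i ≫ f) :=
      IsPullback.of_isLimit' ⟨by simp⟩ <| PullbackCone.IsLimit.mk _ (fun s => s.snd)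
        (fun s => by rw [← cancel_mono f, s.condition, Category.assoc]) (fun s => by simp)
        (fun s m _ hm => by simpa using hm)
    have h₃ := h₂.paste_vert (isPullback_χ (i ≫ f))
    rw [Category.id_comp] at h₃
    exact (unique i _ h₃).trans (unique i _ h₁).symm

variable [CartesianMonoidalCategory E]

/-- Exponentials of injective objects are injective. -/
instance injective_ihom [MonoidalClosed E] (A W : E) [Injective W] :
    Injective ((ihom A).obj W) := by
  have : (tensorLeft A).PreservesMonomorphisms :=
    ⟨fun {X Y} f hf => ⟨fun {T} a b h => by
      have h : a ≫ A ◁ f = b ≫ A ◁ f := h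
      apply CartesianMonoidalCategory.hom_ext
      · simpa using h =≫ fst _ _
      · simpa [← cancel_mono f] using h =≫ snd _ _⟩⟩
  exact (ihom.adjunction A).map_injective W inferInstance

/-- The morphism `X ⟶ Ω ^ X` sending an element to its singleton. -/
noncomputable def singleton [MonoidalClosed E] [HasSubobjectClassifier E] (X : E) :
    X ⟶ (ihom X).obj (Ω E) :=
  curry (χ (lift (𝟙 X) (𝟙 X)))

instance mono_singleton [MonoidalClosed E] [HasSubobjectClassifier E] (X : E) :
    Mono (singleton X) where
  right_cancellation {T} a b h := by
    unfold singleton at h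
    rw [← curry_natural_left, ← curry_natural_left] at h
    -- Evaluating both singletons at `a` shows that `(a, b)` factors through the diagonal.
    have h := lift a (𝟙 T) ≫= curry_injective h
    rw [lift_whiskerLeft_assoc, lift_whiskerLeft_assoc, Category.id_comp, Category.id_comp] at h
    have ha : lift a a = a ≫ lift (𝟙 X) (𝟙 X) := by simp
    rw [ha, Category.assoc, HasSubobjectClassifier.comm,
      ← Category.assoc] at h
    have hP := isPullback_χ (lift (𝟙 X) (𝟙 X))
    have hl := hP.lift_fst _ _ h.symm
    have h₁ := hl =≫ fst _ _
    have h₂ := hl =≫ snd _ _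
    simp only [Category.assoc, lift_fst, lift_snd, Category.comp_id] at h₁ h₂
    exact h₁.symm.trans h₂

/-- The naturality square of the second projection is a pullback. -/
lemma isPullback_whiskerLeft_snd (B : E) {X Y : E} (u : X ⟶ Y) :
    IsPullback (B ◁ u) (snd B X) (snd B Y) u :=
  IsPullback.of_isLimit' ⟨by simp⟩ <|
    PullbackCone.IsLimit.mk _ (fun s => lift (s.fst ≫ fst _ _) s.snd)
      (fun s => by
        have := s.condition
        apply CartesianMonoidalCategory.hom_ext <;> simp [this])
      (fun s => by simp)
      (fun s m h₁ h₂ => by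
        apply CartesianMonoidalCategory.hom_ext
        · simp [← h₁]
        · simpa using h₂)

end Topos

section Glueing

variable {E : Type u₁} [Category.{v₁} E] {S : Type u₂} [Category.{v₂} S] {F : S ⥤ E}

/-- A morphism of `E ↓ F` whose underlying square is a pullback is cartesian for `gl F`. -/
lemma isStronglyCartesian_of_isPullback {b a : Comma (𝟭 E) F} (φ : b ⟶ a)
    (h : IsPullback (Z := F.obj a.right) φ.left b.hom a.hom (F.map φ.right)) :
    (gl F).IsStronglyCartesian ((gl F).map φ) φ where
  toIsHomLift := inferInstance
  universal_property' {c} g ψ hψ := by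
    have hr : ψ.right = g ≫ φ.right :=
      (IsHomLift.eq_of_isHomLift (gl F) (g ≫ (gl F).map φ) ψ).symm
    have hw : ψ.left ≫ a.hom = (c.hom ≫ F.map g) ≫ F.map φ.right := by
      have := ψ.w
      rw [hr] at this
      simpa using this
    let κ : c ⟶ b :=
      { left := h.lift ψ.left (c.hom ≫ F.map g) hw
        right := g
        w := h.lift_snd _ _ _ }
    refine ⟨κ, ⟨Functor.IsHomLift.map (p := gl F) κ, ?_⟩, ?_⟩
    · ext
      · exact h.lift_fst _ _ _
      · exact hr.symm
    · rintro θ ⟨hθ, hθφ⟩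
      have hθr : θ.right = g := (IsHomLift.eq_of_isHomLift (a := c) (b := b) (gl F) g θ).symm
      apply CommaMorphism.ext
      · apply h.hom_ext
        · exact (congrArg CommaMorphism.left hθφ).trans (h.lift_fst _ _ _).symm
        · refine Eq.trans ?_ (h.lift_snd _ _ _).symm
          have := θ.w
          rw [hθr] at this
          exact this
      · exact hθr

/-- If `φ : b ⟶ a` is cartesian for `gl F`, then `b.left` is a subobject of
`a.left × F b.right`. -/
lemma mono_lift_of_isStronglyCartesian [CartesianMonoidalCategory E] {b a : Comma (𝟭 E) F}
    (φ : b ⟶ a) [(gl F).IsStronglyCartesian ((gl F).map φ) φ] :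
    Mono (lift (X := a.left) (Y := F.obj b.right) φ.left b.hom) where
  right_cancellation {T} x y h := by
    have h₁ : x ≫ φ.left = y ≫ φ.left := by simpa using h =≫ fst _ _
    have h₂ : x ≫ b.hom = y ≫ b.hom := by simpa using h =≫ snd _ _
    let c : Comma (𝟭 E) F := { left := T, right := b.right, hom := x ≫ b.hom }
    let x' : c ⟶ b := { left := x, right := 𝟙 _, w := by simp [c] }
    let y' : c ⟶ b := { left := y, right := 𝟙 _, w := by simp [c, h₂] }
    have hx : (gl F).IsHomLift (𝟙 b.right) x' := Functor.IsHomLift.map (p := gl F) x'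
    have hy : (gl F).IsHomLift (𝟙 b.right) y' := Functor.IsHomLift.map (p := gl F) y'
    have hxy : x' ≫ φ = y' ≫ φ := by
      ext
      · exact h₁
      · rfl
    have := Functor.IsStronglyCartesian.ext (gl F) ((gl F).map φ) φ (𝟙 b.right) hxy
    exact congrArg CommaMorphism.left this

end Glueing

variable {E : Type u₁} [Category.{v₁} E] [CartesianMonoidalCategory E] [MonoidalClosed E]
  {S : Type u₂} [Category.{v₂} S] (f : GeometricMorphism E S)

namespace GeometricMorphism

/-- The evaluation `A × F U (W ^ A) ⟶ W`. -/
noncomputable def eval (A W : E) :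
    A ⊗ f.inverseImage.obj (f.directImage.obj ((ihom A).obj W)) ⟶ W :=
  uncurry (f.adj.counit.app _)

/-- Every morphism `A × F L ⟶ W` is obtained from the evaluation `A × F U (W ^ A) ⟶ W`. -/
lemma exists_whiskerLeft_eval {A W : E} {L : S} (h : A ⊗ f.inverseImage.obj L ⟶ W) :
    ∃ k : L ⟶ f.directImage.obj ((ihom A).obj W), A ◁ f.inverseImage.map k ≫ f.eval A W = h := by
  refine ⟨f.adj.homEquiv _ _ (curry h), ?_⟩
  rw [eval, ← uncurry_natural_left, ← Adjunction.homEquiv_counit, Equiv.symm_apply_apply,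
    uncurry_curry]

variable [HasFiniteLimits E] [HasSubobjectClassifier E]

/-- The family of all subobjects of `B`, indexed by `U (Ω ^ B)`. -/
noncomputable def subobjectFamily (B : E) : Comma (𝟭 E) f.inverseImage where
  left := pullback (f.eval B (Ω E)) (truth E)
  right := f.directImage.obj ((ihom B).obj (Ω E))
  hom := pullback.fst (f.eval B (Ω E)) (truth E) ≫ snd _ _

/-- Every subobject of `B × F L`, seen as a family over `F L`, is a reindexing of the family of
all subobjects of `B`. -/
lemma exists_isStronglyCartesian_subobjectFamily {B C : E} {L : S}
    (m : C ⟶ B ⊗ f.inverseImage.obj L) [Mono m] :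
    ∃ φ : (Comma.mk (L := 𝟭 E) (R := f.inverseImage) (left := C) (right := L) (m ≫ snd _ _)) ⟶
        f.subobjectFamily B,
      (gl f.inverseImage).IsStronglyCartesian ((gl f.inverseImage).map φ) φ := by
  obtain ⟨k, hk⟩ := f.exists_whiskerLeft_eval (χ m)
  have hm := isPullback_χ m
  rw [← hk] at hm
  have hp := (hm.of_bot' (IsPullback.of_hasPullback (f.eval B (Ω E)) (truth E))).flip.paste_vert
    (isPullback_whiskerLeft_snd B (f.inverseImage.map k))
  exact ⟨{ left := _, right := k, w := hp.w }, isStronglyCartesian_of_isPullback _ hp⟩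

theorem isGeneratingFamily_subobjectFamily [CartesianMonoidalCategory S] {B : E}
    (hB : f.IsBound B) :
    IsGeneratingFamily (gl f.inverseImage) (f.subobjectFamily B) := by
  intro J X Y α₁ α₂ h₁ h₂ hne
  obtain ⟨I, C, m, e, hm, he⟩ := hB X.left
  have := f.preservesFiniteLimits
  -- Enlarging the index to `I ⊗ X.right` lets `e` lie over the second projection; `n` stays monic
  -- because the first projection recovers `m`.
  let n : C ⟶ B ⊗ f.inverseImage.obj (I ⊗ X.right) :=
    lift (m ≫ fst _ _) (lift (m ≫ snd _ _) (e ≫ X.hom) ≫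
      inv (CartesianMonoidalCategory.prodComparison f.inverseImage I X.right))
  have hn : n ≫ B ◁ f.inverseImage.map (fst _ _) = m := by
    apply CartesianMonoidalCategory.hom_ext <;> simp [n]
  have : Mono n := by
    have : Mono (n ≫ B ◁ f.inverseImage.map (fst _ _)) := hn ▸ hm
    exact mono_of_mono n (B ◁ f.inverseImage.map (fst _ _))
  obtain ⟨φ, hφ⟩ := f.exists_isStronglyCartesian_subobjectFamily n
  refine ⟨_, φ, { left := e, right := snd _ _, w := by simp [n] }, hφ, fun h => hne ?_⟩
  ext
  · have h := congrArg CommaMorphism.left h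
    exact (cancel_epi e).1 h
  · exact (IsHomLift.fac' (gl f.inverseImage) (𝟙 J) α₁).trans
      (IsHomLift.fac' (gl f.inverseImage) (𝟙 J) α₂).symm

theorem isBound_of_isGeneratingFamily [CartesianMonoidalCategory S]
    {G : Comma (𝟭 E) f.inverseImage} (hG : IsGeneratingFamily (gl f.inverseImage) G) :
    f.IsBound G.left := by
  intro X
  have := f.preservesFiniteLimits
  let ε := f.eval G.left ((ihom X).obj (Ω E))
  refine ⟨_, pullback ε (singleton X), pullback.fst _ _, pullback.snd _ _, inferInstance,
    ⟨fun {Y} α β h => ?_⟩⟩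
  by_contra hne
  have ht : IsTerminal (f.inverseImage.obj (𝟙_ S)) :=
    isTerminalTensorUnit.isTerminalObj f.inverseImage _
  -- Over the terminal object, every map of `E` becomes vertical.
  let X' : Comma (𝟭 E) f.inverseImage := { left := X, right := 𝟙_ S, hom := ht.from _ }
  let Y' : Comma (𝟭 E) f.inverseImage := { left := Y, right := 𝟙_ S, hom := ht.from _ }
  let α' : X' ⟶ Y' := { left := α, right := 𝟙 _, w := ht.hom_ext _ _ }
  let β' : X' ⟶ Y' := { left := β, right := 𝟙 _, w := ht.hom_ext _ _ }
  obtain ⟨Z, φ, ψ, hφ, hψ⟩ := hG (𝟙_ S) X' Y' α' β'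
    (Functor.IsHomLift.map (p := gl f.inverseImage) α')
    (Functor.IsHomLift.map (p := gl f.inverseImage) β')
    (fun h => hne (congrArg CommaMorphism.left h))
  have := mono_lift_of_isStronglyCartesian φ
  let m : Z.left ⟶ G.left ⊗ f.inverseImage.obj Z.right := lift φ.left Z.hom
  have : Mono m := this
  -- Here injectivity of `Ω ^ X` extends the partial map `(m, ψ.left)`.
  obtain ⟨g, hg⟩ := Injective.factors (ψ.left ≫ singleton X) m
  obtain ⟨k, hk⟩ := f.exists_whiskerLeft_eval g
  have hw : (m ≫ G.left ◁ f.inverseImage.map k) ≫ ε = ψ.left ≫ singleton X := by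
    rw [Category.assoc, hk, hg]
  have hl : pullback.lift _ _ hw ≫ pullback.snd _ _ = ψ.left := pullback.lift_snd _ _ _
  apply hψ
  ext
  change ψ.left ≫ α = ψ.left ≫ β
  rw [← hl, Category.assoc, Category.assoc, h]

end GeometricMorphism

end FibTopos

theorem mainTheorem4
    {E : Type u₁} [Category.{v₁} E] [CartesianMonoidalCategory E] [HasFiniteLimits E]
    [MonoidalClosed E] [HasSubobjectClassifier E]
    {S : Type u₂} [Category.{v₂} S] [CartesianMonoidalCategory S] [HasFiniteLimits S]
    [MonoidalClosed S] [HasSubobjectClassifier S]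
    (f : FibTopos.GeometricMorphism E S) :
    f.IsBounded ↔
      ∃ G : Comma (𝟭 E) f.inverseImage,
        FibTopos.IsGeneratingFamily (FibTopos.gl f.inverseImage) G :=
  ⟨fun ⟨B, hB⟩ => ⟨f.subobjectFamily B, f.isGeneratingFamily_subobjectFamily hB⟩,
    fun ⟨G, hG⟩ => ⟨G.left, f.isBound_of_isGeneratingFamily hG⟩⟩
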